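/- Let $\{\Phi_e\}_{e\in\mathbb N}$ be an effective enumeration of all Turing functionals, and write $\Phi_e(g;n)$ for the (possibly undefined) value on input $n\in\mathbb N$ with oracle $g\in\mathbb N^{\mathbb N}$; $\Phi_e(g)=h$ means $\Phi_e(g;n)=h(n)$ for all $n$. Let $\{\varphi_e\}_{e\in\mathbb N}$ be a standard numbering of the partial computable functions on $\mathbb N$. For $k\in\mathbb N$ let $$\mathsf{DNR}_k=\{f\in\mathbb N^{\mathbb N}: f(n)<k \text{ for all } n,\ \text{and } f(e)\neq\varphi_e(e)\text{ whenever }\varphi_e(e)\text{ converges}\}.$$ A partial function $\Gamma:\subseteq\mathbb N^{\mathbb N}\to\mathbb N^{\mathbb N}$ is - *$({<}\omega,1)$-computable* if there is $b\in\mathbb N$ such that for every $g\in\mathrm{dom}(\Gamma)$ there is $e<b$ with $\Phi_e(g)=\Gamma(g)$; - *$(1,\omega)$-computable* (learnable) if there is a partial computable function $\Psi:\subseteq\mathbb N^{<\mathbb N}\to\mathbb N$ (a learner) such that for every $g\in\mathrm{dom}(\Gamma)$ the limit $i=\lim_n\Psi(g\upharpoonright n)$ exists (i.e. $\Psi(g\upharpoonright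 n)$ is defined and equal to $i$ for all sufficiently large $n$) and $\Phi_i(g)=\Gamma(g)$. For $P,Q\subseteq\mathbb N^{\mathbb N}$ write $P\le^{<\omega}_1 Q$ (respectively $P\le^1_\omega Q$) if there is a $({<}\omega,1)$-computable (respectively $(1,\omega)$-computable) partial function $\Gamma$ with $Q\subseteq\mathrm{dom}(\Gamma)$ and $\Gamma(g)\in P$ for all $g\in Q$; write $P<Q$ for the corresponding strict relation: $P\le Q$ and not $Q\le P$. **Corollary.** $\mathsf{DNR}_3<^{<\omega}_1\mathsf{DNR}_2$ and $\mathsf{DNR}_3<^1_\omega\mathsf{DNR}_2$. In particular, no $({<}\omega,1)$-computable function and no learnable function maps $\mathsf{DNR}_3$ into $\mathsf{DNR}_2$. -/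

import Mathlib

/-! ### Turing functionals -/

/-- Programs for oracle computation: Mathlib's instructions for the partial recursive functions
together with one instruction that queries the oracle. -/
inductive OracleCode : Type
  | zero : OracleCode
  | succ : OracleCode
  | left : OracleCode
  | right : OracleCode
  | oracle : OracleCode
  | pair : OracleCode → OracleCode → OracleCode
  | comp : OracleCode → OracleCode → OracleCode
  | prec : OracleCode → OracleCode → OracleCode
  | rfind : OracleCode → OracleCode

namespace OracleCode

/-- The partial function computed by a program with oracle `g`; the clauses are those of
`Nat.RecursiveIn`. -/
def eval (g : ℕ →. ℕ) : OracleCode → ℕ →. ℕ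
  | zero => fun _ => 0
  | succ => Nat.succ
  | left => fun n => (Nat.unpair n).1
  | right => fun n => (Nat.unpair n).2
  | oracle => g
  | pair cf ch => fun n => Nat.pair <$> eval g cf n <*> eval g ch n
  | comp cf ch => fun n => eval g ch n >>= eval g cf
  | prec cf ch => fun p =>
      let (a, n) := Nat.unpair p
      n.rec (eval g cf a) fun y IH => do
        let i ← IH
        eval g ch (Nat.pair a (Nat.pair y i))
  | rfind cf => fun a => Nat.rfind fun n => (fun m => m = 0) <$> eval g cf (Nat.pair a n)

/-- The Gödel number of a program. -/
def encodeCode : OracleCode → ℕ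
  | zero => 0
  | succ => 1
  | left => 2
  | right => 3
  | oracle => 4
  | pair cf ch => 2 * (2 * Nat.pair (encodeCode cf) (encodeCode ch)) + 5
  | comp cf ch => 2 * (2 * Nat.pair (encodeCode cf) (encodeCode ch) + 1) + 5
  | prec cf ch => (2 * (2 * Nat.pair (encodeCode cf) (encodeCode ch)) + 1) + 5
  | rfind cf => (2 * (2 * encodeCode cf + 1) + 1) + 5

/-- The program with a given Gödel number. -/
def ofNatCode : ℕ → OracleCode
  | 0 => zero
  | 1 => succ
  | 2 => left
  | 3 => right
  | 4 => oracle
  | n + 5 =>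
    let m := n.div2.div2
    match n.bodd, n.div2.bodd with
    | false, false => pair (ofNatCode m.unpair.1) (ofNatCode m.unpair.2)
    | false, true => comp (ofNatCode m.unpair.1) (ofNatCode m.unpair.2)
    | true, false => prec (ofNatCode m.unpair.1) (ofNatCode m.unpair.2)
    | true, true => rfind (ofNatCode m)
  decreasing_by
    all_goals
      have hm : n.div2.div2 < n + 5 := by
        simp only [Nat.div2_val]
        omega
      first
        | exact hm
        | exact lt_of_le_of_lt (Nat.unpair_left_le _) hm
        | exact lt_of_le_of_lt (Nat.unpair_right_le _) hm

theorem ofNatCode_encodeCode (c : OracleCode) : ofNatCode (encodeCode c) = c := by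
  induction c <;> simp [encodeCode, ofNatCode, Nat.div2_val, *]

theorem exists_eval_eq_iff (g f : ℕ →. ℕ) : (∃ c, eval g c = f) ↔ Nat.RecursiveIn {g} f := by
  constructor
  · rintro ⟨c, rfl⟩
    induction c with
    | zero => exact .zero
    | succ => exact .succ
    | left => exact .left
    | right => exact .right
    | oracle => exact .oracle g rfl
    | pair _ _ h₁ h₂ => exact .pair h₁ h₂
    | comp _ _ h₁ h₂ => exact .comp h₁ h₂
    | prec _ _ h₁ h₂ => exact .prec h₁ h₂
    | rfind _ h => exact .rfind h
  · intro h
    induction h with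
    | zero => exact ⟨zero, rfl⟩
    | succ => exact ⟨succ, rfl⟩
    | left => exact ⟨left, rfl⟩
    | right => exact ⟨right, rfl⟩
    | oracle f hf => exact ⟨oracle, (Set.mem_singleton_iff.1 hf).symm⟩
    | pair _ _ h₁ h₂ =>
      obtain ⟨⟨c, rfl⟩, ⟨d, rfl⟩⟩ := And.intro h₁ h₂
      exact ⟨pair c d, rfl⟩
    | comp _ _ h₁ h₂ =>
      obtain ⟨⟨c, rfl⟩, ⟨d, rfl⟩⟩ := And.intro h₁ h₂
      exact ⟨comp c d, rfl⟩
    | prec _ _ h₁ h₂ =>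
      obtain ⟨⟨c, rfl⟩, ⟨d, rfl⟩⟩ := And.intro h₁ h₂
      exact ⟨prec c d, rfl⟩
    | rfind _ h =>
      obtain ⟨c, rfl⟩ := h
      exact ⟨rfind c, rfl⟩

end OracleCode

/-- `turingFunctional e g n` is `Φ_e(g; n)`, where `Φ_0, Φ_1, …` is an effective enumeration of all
Turing functionals. -/
def turingFunctional (e : ℕ) (g : ℕ → ℕ) : ℕ →. ℕ :=
  (OracleCode.ofNatCode e).eval (g : ℕ →. ℕ)

/-- `Φ_e(g) = h`, that is, `Φ_e(g)` is total with the values of `h`. -/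
def FunctionalMapsTo (e : ℕ) (g h : ℕ → ℕ) : Prop :=
  ∀ n, h n ∈ turingFunctional e g n

/-! ### Classes of partial functions on Baire space -/

/-- `(<ω, 1)`-computability: for some `b`, each `g` in the domain of `Γ` has an index `e < b` with
`Φ_e(g) = Γ(g)`. -/
def FinitelyPiecewiseComputable (Γ : (ℕ → ℕ) →. (ℕ → ℕ)) : Prop :=
  ∃ b : ℕ, ∀ g h, h ∈ Γ g → ∃ e < b, FunctionalMapsTo e g h

/-- The initial segment of `g` of length `n`. -/
def initSeg (g : ℕ → ℕ) (n : ℕ) : List ℕ :=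
  (List.range n).map g

/-- `lim_n Ψ(g ↾ n)` converges to some index `i` (so `Ψ(g ↾ n)` is defined with value `i` for all
sufficiently large `n`), and `Φ_i(g) = h`. -/
def Identifies (Ψ : List ℕ →. ℕ) (g h : ℕ → ℕ) : Prop :=
  ∃ i, (∀ᶠ n in Filter.atTop, i ∈ Ψ (initSeg g n)) ∧ FunctionalMapsTo i g h

/-- `(1, ω)`-computability: `Γ` is identified, on every element of its domain, by one learner,
a learner being a partial computable function from finite strings to indices. -/
def Learnable (Γ : (ℕ → ℕ) →. (ℕ → ℕ)) : Prop :=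
  ∃ Ψ : List ℕ →. ℕ, Partrec Ψ ∧ ∀ g h, h ∈ Γ g → Identifies Ψ g h

/-! ### Reducibility of mass problems -/

/-- `P ≤_F Q`: some partial function in the class `F` is defined on all of `Q` and maps `Q`
into `P`. -/
def MassLE (F : ((ℕ → ℕ) →. (ℕ → ℕ)) → Prop) (P Q : Set (ℕ → ℕ)) : Prop :=
  ∃ Γ : (ℕ → ℕ) →. (ℕ → ℕ), F Γ ∧ ∀ g ∈ Q, ∃ h ∈ Γ g, h ∈ P

/-- `P <_F Q`. -/
def MassLT (F : ((ℕ → ℕ) →. (ℕ → ℕ)) → Prop) (P Q : Set (ℕ → ℕ)) : Prop :=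
  MassLE F P Q ∧ ¬ MassLE F Q P

/-- The `k`-valued diagonally noncomputable functions, with respect to Mathlib's numbering of the
partial recursive functions on `ℕ`. -/
def DNR (k : ℕ) : Set (ℕ → ℕ) :=
  {f | (∀ n, f n < k) ∧
    ∀ e, f e ∉ (Denumerable.ofNat Nat.Partrec.Code e).eval e}

/-! The positive reductions are the identity, as `DNR 2 ⊆ DNR 3`. For the negative ones, fix a
finite set `E` of functionals and `f ∈ DNR 3`, and suppose that on every member of `DNR 3` agreeing
with `f` below `l` some functional in `E` computes a member of `DNR 2`. Call `v` large at `n` if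
every ternary `p` extending the `{0,1,2}`-valued part of the diagonal function is avoided, from `l`
on, by a finite ternary string that starts like `f` and makes some functional in `E` output `v` at
`n`. If neither 0 nor 1 were large, with counterexamples `p 0` and `p 1`, a ternary function
avoiding both would be diagonally noncomputable, and no functional in `E` could give it an output in
`{0, 1}` at `n`. So each `n` has a large `v`.

By compactness, largeness has a finite certificate and can be searched for. The recursion theorem
gives an `n` whose diagonal value is itself large at `n`; hence some `g ∈ DNR 3` near `f` makes a
functional in `E` output the forbidden value at `n` (`exists_diagonal_value_of_forall_exists`). This
mistake has finite use, so it can be frozen; induction on `E` defeats all of `E` near any `f`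
(`exists_dnr_three_forall_not_mapsTo_dnr_two`). That settles the finitely piecewise computable case.
For learners, the Baire category theorem on the closed set `DNR 3` makes the limit index constant
near some `f`, and a singleton `E` suffices. -/

namespace OracleCode

/-! ### Oracle computations: monotonicity, use and uniform computability. -/

theorem mem_eval_pair {g : ℕ →. ℕ} {c d : OracleCode} {n v : ℕ} :
    v ∈ eval g (pair c d) n ↔ ∃ a ∈ eval g c n, ∃ b ∈ eval g d n, Nat.pair a b = v := by
  simp [eval, Seq.seq, Part.bind_map]

theorem mem_eval_comp {g : ℕ →. ℕ} {c d : OracleCode} {n v : ℕ} :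
    v ∈ eval g (comp c d) n ↔ ∃ a ∈ eval g d n, v ∈ eval g c a :=
  Part.mem_bind_iff

theorem eval_prec_zero {g : ℕ →. ℕ} {c d : OracleCode} {n : ℕ} :
    eval g (prec c d) (Nat.pair n 0) = eval g c n := by
  simp [eval]

theorem mem_eval_prec_succ {g : ℕ →. ℕ} {c d : OracleCode} {n m v : ℕ} :
    v ∈ eval g (prec c d) (Nat.pair n (m + 1)) ↔
      ∃ a ∈ eval g (prec c d) (Nat.pair n m), v ∈ eval g d (Nat.pair n (Nat.pair m a)) := by
  simp [eval]

theorem mem_eval_rfind {g : ℕ →. ℕ} {c : OracleCode} {n v : ℕ} :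
    v ∈ eval g (rfind c) n ↔
      0 ∈ eval g c (Nat.pair n v) ∧ ∀ m < v, ∃ b ∈ eval g c (Nat.pair n m), b ≠ 0 := by
  refine Nat.mem_rfind.trans ?_
  simp

/-- Converging oracle computations are preserved when the oracle is extended. -/
theorem eval_mono {g g' : ℕ →. ℕ} (hg : ∀ n, ∀ v ∈ g n, v ∈ g' n) (c : OracleCode) :
    ∀ n, ∀ v ∈ eval g c n, v ∈ eval g' c n := by
  induction c with
  | zero => exact fun _ _ h => h
  | succ => exact fun _ _ h => h
  | left => exact fun _ _ h => h
  | right => exact fun _ _ h => h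
  | oracle => exact hg
  | pair c d hc hd =>
    intro n v h
    obtain ⟨a, ha, b, hb, h⟩ := mem_eval_pair.1 h
    exact mem_eval_pair.2 ⟨a, hc _ _ ha, b, hd _ _ hb, h⟩
  | comp c d hc hd =>
    intro n v h
    obtain ⟨a, ha, h⟩ := mem_eval_comp.1 h
    exact mem_eval_comp.2 ⟨a, hd _ _ ha, hc _ _ h⟩
  | prec c d hc hd =>
    intro n
    rw [← Nat.pair_unpair n]
    induction n.unpair.2 with
    | zero => simpa only [eval_prec_zero] using hc _
    | succ m ih =>
      intro v h
      obtain ⟨a, ha, h⟩ := mem_eval_prec_succ.1 h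
      exact mem_eval_prec_succ.2 ⟨a, ih _ ha, hd _ _ h⟩
  | rfind c hc =>
    intro n v h
    obtain ⟨h, h'⟩ := mem_eval_rfind.1 h
    refine mem_eval_rfind.2 ⟨hc _ _ h, fun m hm => ?_⟩
    obtain ⟨b, hb, h''⟩ := h' m hm
    exact ⟨b, hc _ _ hb, h''⟩

end OracleCode

/-- The oracle that answers as `f` below `k` and does not answer from `k` on. -/
def restrictBelow (f : ℕ → ℕ) (k : ℕ) : ℕ →. ℕ :=
  fun x => ((if x < k then some (f x) else none : Option ℕ) : Part ℕ)

theorem mem_restrictBelow {f : ℕ → ℕ} {k x v : ℕ} :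
    v ∈ restrictBelow f k x ↔ x < k ∧ f x = v := by
  unfold restrictBelow
  split_ifs with h <;> simp [h, eq_comm]

theorem restrictBelow_congr {f f' : ℕ → ℕ} {k : ℕ} (h : ∀ x < k, f x = f' x) :
    restrictBelow f k = restrictBelow f' k := by
  funext x
  unfold restrictBelow
  split_ifs with hx
  · rw [h x hx]
  · rfl

namespace OracleCode

theorem eval_restrictBelow_mono {f : ℕ → ℕ} {k l : ℕ} (hkl : k ≤ l) {c : OracleCode} {n v : ℕ}
    (h : v ∈ eval (restrictBelow f k) c n) : v ∈ eval (restrictBelow f l) c n := by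
  refine eval_mono (fun x w hw => ?_) c n v h
  rw [mem_restrictBelow] at hw ⊢
  exact ⟨hw.1.trans_le hkl, hw.2⟩

theorem mem_eval_of_restrictBelow {f : ℕ → ℕ} {k : ℕ} {c : OracleCode} {n v : ℕ}
    (h : v ∈ eval (restrictBelow f k) c n) : v ∈ eval (f : ℕ →. ℕ) c n := by
  refine eval_mono (fun x w hw => ?_) c n v h
  rw [mem_restrictBelow] at hw
  simp [hw.2]

/-- The use principle: a converging computation queries only finitely many oracle values. -/
theorem exists_mem_eval_restrictBelow (f : ℕ → ℕ) (c : OracleCode) :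
    ∀ n, ∀ v ∈ eval (f : ℕ →. ℕ) c n, ∃ k, v ∈ eval (restrictBelow f k) c n := by
  induction c with
  | zero => exact fun _ _ h => ⟨0, h⟩
  | succ => exact fun _ _ h => ⟨0, h⟩
  | left => exact fun _ _ h => ⟨0, h⟩
  | right => exact fun _ _ h => ⟨0, h⟩
  | oracle =>
    intro n v h
    refine ⟨n + 1, ?_⟩
    simp only [eval, PFun.coe_val, Part.mem_some_iff] at h
    exact mem_restrictBelow.2 ⟨n.lt_succ_self, h.symm⟩
  | pair c d hc hd =>
    intro n v h
    obtain ⟨a, ha, b, hb, h⟩ := mem_eval_pair.1 h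
    obtain ⟨k, hk⟩ := hc _ _ ha
    obtain ⟨l, hl⟩ := hd _ _ hb
    exact ⟨max k l, mem_eval_pair.2 ⟨a, eval_restrictBelow_mono (le_max_left _ _) hk, b,
      eval_restrictBelow_mono (le_max_right _ _) hl, h⟩⟩
  | comp c d hc hd =>
    intro n v h
    obtain ⟨a, ha, h⟩ := mem_eval_comp.1 h
    obtain ⟨k, hk⟩ := hd _ _ ha
    obtain ⟨l, hl⟩ := hc _ _ h
    exact ⟨max k l, mem_eval_comp.2 ⟨a, eval_restrictBelow_mono (le_max_left _ _) hk,
      eval_restrictBelow_mono (le_max_right _ _) hl⟩⟩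
  | prec c d hc hd =>
    intro n
    rw [← Nat.pair_unpair n]
    induction n.unpair.2 with
    | zero => simpa only [eval_prec_zero] using hc _
    | succ m ih =>
      intro v h
      obtain ⟨a, ha, h⟩ := mem_eval_prec_succ.1 h
      obtain ⟨k, hk⟩ := ih _ ha
      obtain ⟨l, hl⟩ := hd _ _ h
      exact ⟨max k l, mem_eval_prec_succ.2 ⟨a, eval_restrictBelow_mono (le_max_left _ _) hk,
        eval_restrictBelow_mono (le_max_right _ _) hl⟩⟩
  | rfind c hc =>
    intro n v h
    obtain ⟨h, h'⟩ := mem_eval_rfind.1 h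
    obtain ⟨k, hk⟩ := hc _ _ h
    have h'' : ∀ m, ∃ l, m < v → ∃ b ∈ eval (restrictBelow f l) c (Nat.pair n m), b ≠ 0 := by
      intro m
      by_cases hm : m < v
      · obtain ⟨b, hb, hb'⟩ := h' m hm
        obtain ⟨l, hl⟩ := hc _ _ hb
        exact ⟨l, fun _ => ⟨b, hl, hb'⟩⟩
      · exact ⟨0, fun h => absurd h hm⟩
    choose l hl using h''
    refine ⟨max k ((Finset.range v).sup l), mem_eval_rfind.2
      ⟨eval_restrictBelow_mono (le_max_left _ _) hk, fun m hm => ?_⟩⟩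
    obtain ⟨b, hb, hb'⟩ := hl m hm
    exact ⟨b, eval_restrictBelow_mono
      ((Finset.le_sup (Finset.mem_range.2 hm)).trans (le_max_right _ _)) hb, hb'⟩

/-- A fixed oracle program is partial computable uniformly in a partial computable oracle. -/
theorem partrec₂_eval {α : Type*} [Primcodable α] {g : α → ℕ →. ℕ} (hg : Partrec₂ g)
    (c : OracleCode) : Partrec₂ fun a n => eval (g a) c n := by
  induction c with
  | zero => exact (Computable.const 0).partrec
  | succ => exact (Computable.succ.comp Computable.snd).partrec
  | left => exact (Computable.fst.comp (Computable.unpair.comp Computable.snd)).partrec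
  | right => exact (Computable.snd.comp (Computable.unpair.comp Computable.snd)).partrec
  | oracle => exact hg
  | pair c d hc hd =>
    refine (Partrec.bind hc (Partrec.map
      (hd.comp (Computable.fst.comp Computable.fst) (Computable.snd.comp Computable.fst))
      (g := fun (q : (α × ℕ) × ℕ) m => Nat.pair q.2 m)
      (Primrec₂.natPair.to_comp.comp (Computable.snd.comp Computable.fst)
        Computable.snd).to₂).to₂).of_eq fun q => ?_
    simp [eval, Seq.seq, Part.bind_map]
  | comp c d hc hd =>
    exact Partrec.bind hd (hc.comp (Computable.fst.comp Computable.fst) Computable.snd).to₂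
  | prec c d hc hd =>
    have ha : Computable fun q : α × ℕ => q.2.unpair.1 :=
      Computable.fst.comp (Computable.unpair.comp Computable.snd)
    refine (Partrec.nat_rec (f := fun q : α × ℕ => q.2.unpair.2)
      (g := fun q => eval (g q.1) c q.2.unpair.1)
      (h := fun q r => eval (g q.1) d (Nat.pair q.2.unpair.1 (Nat.pair r.1 r.2)))
      (Computable.snd.comp (Computable.unpair.comp Computable.snd))
      (hc.comp Computable.fst ha)
      (hd.comp (Computable.fst.comp Computable.fst)
        (Primrec₂.natPair.to_comp.comp (ha.comp Computable.fst)
          (Primrec₂.natPair.to_comp.comp (Computable.fst.comp Computable.snd)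
            (Computable.snd.comp Computable.snd)))).to₂).of_eq fun q => ?_
    simp [eval]
  | rfind c hc =>
    refine Partrec.rfind (p := fun (q : α × ℕ) n =>
      (fun m => decide (m = 0)) <$> eval (g q.1) c (Nat.pair q.2 n)) ?_
    refine Partrec.map (hc.comp (Computable.fst.comp Computable.fst)
      (Primrec₂.natPair.to_comp.comp (Computable.snd.comp Computable.fst) Computable.snd)) ?_
    exact (((PrimrecRel.comp Primrec.eq Primrec.id (Primrec.const 0)).decide).comp
      Primrec.snd).to₂.to_comp

end OracleCode

/-! ### Coding of finite ternary strings, and compactness. -/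

/-- The `x`-th ternary digit of `P`. -/
def ternaryDigit (P x : ℕ) : ℕ := P / 3 ^ x % 3

theorem ternaryDigit_lt (P x : ℕ) : ternaryDigit P x < 3 := Nat.mod_lt _ (by norm_num)

theorem exists_ternaryDigit_eq (k : ℕ) : ∀ f : ℕ → ℕ, (∀ x, f x < 3) →
    ∃ P < 3 ^ k, ∀ x < k, ternaryDigit P x = f x := by
  induction k with
  | zero => exact fun f _ => ⟨0, by simp⟩
  | succ k ih =>
    intro f hf
    obtain ⟨P, hP, h⟩ := ih (fun x => f (x + 1)) fun x => hf _
    refine ⟨f 0 + 3 * P, ?_, ?_⟩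
    · have := hf 0
      rw [pow_succ]
      omega
    · rintro (_ | x) hx
      · have := hf 0
        simp only [ternaryDigit, pow_zero, Nat.div_one]
        omega
      · have h0 := hf 0
        rw [← h x (by omega), ternaryDigit, ternaryDigit, pow_succ', ← Nat.div_div_eq_div_mul]
        congr 2
        omega

theorem primrec₂_ternaryDigit : Primrec₂ ternaryDigit :=
  Primrec.nat_mod.comp (Primrec.nat_div.comp Primrec.fst
    ((Primrec₂.unpaired'.1 Nat.Primrec.pow).comp (Primrec.const 3) Primrec.snd))
    (Primrec.const 3)

/-- Compactness of the space of ternary functions. -/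
theorem exists_bound_of_forall_ternary {U : ℕ → ℕ → (ℕ → ℕ) → Prop}
    (hU : ∀ k s p q, (∀ x < k, p x = q x) → U k s p → U k s q)
    (h : ∀ p : ℕ → ℕ, (∀ x, p x < 3) → ∃ k s, U k s p) :
    ∃ K, ∀ p : ℕ → ℕ, (∀ x, p x < 3) → ∃ k < K, ∃ s < K, U k s p := by
  let V : ℕ × ℕ → Set (ℕ → Fin 3) := fun i => {p | U i.1 i.2 fun x => p x}
  have hV : ∀ i, IsOpen (V i) := by
    intro i
    rw [isOpen_iff_forall_mem_open]
    intro p hp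
    refine ⟨PiNat.cylinder p i.1, fun q hq => ?_, PiNat.isOpen_cylinder _ _ _,
      PiNat.self_mem_cylinder _ _⟩
    exact hU _ _ _ _ (fun x hx => by simp only [hq x hx]) hp
  obtain ⟨t, ht⟩ := isCompact_univ.elim_finite_subcover V hV fun p _ => by
    obtain ⟨k, s, hks⟩ := h (fun x => p x) fun x => (p x).2
    exact Set.mem_iUnion.2 ⟨(k, s), hks⟩
  refine ⟨t.sup (fun i => max i.1 i.2) + 1, fun p hp => ?_⟩
  obtain ⟨i, hi, hpi⟩ := Set.mem_iUnion₂.1 (ht (Set.mem_univ fun x => (⟨p x, hp x⟩ : Fin 3)))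
  have := Finset.le_sup (f := fun i : ℕ × ℕ => max i.1 i.2) hi
  exact ⟨i.1, by simp at this ⊢; omega, i.2, by simp at this ⊢; omega, hpi⟩

/-! ### Primitive recursiveness of bounded quantification. -/

theorem PrimrecPred.bounded_exists {α : Type*} [Primcodable α] {b : α → ℕ} {R : ℕ → α → Prop}
    (hR : PrimrecPred fun q : ℕ × α => R q.1 q.2) (hb : Primrec b) :
    PrimrecPred fun a => ∃ x < b a, R x a :=
  ((PrimrecRel.exists_mem_list (R := R) hR).comp (Primrec.list_range.comp hb) .id).of_eq
    fun a => by simp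

theorem PrimrecPred.bounded_forall {α : Type*} [Primcodable α] {b : α → ℕ} {R : ℕ → α → Prop}
    (hR : PrimrecPred fun q : ℕ × α => R q.1 q.2) (hb : Primrec b) :
    PrimrecPred fun a => ∀ x < b a, R x a :=
  ((PrimrecRel.forall_mem_list (R := R) hR).comp (Primrec.list_range.comp hb) .id).of_eq
    fun a => by simp

theorem PrimrecPred.finset_exists {α ι : Type*} [Primcodable α] {R : ι → α → Prop}
    (hR : ∀ i, PrimrecPred (R i)) (E : Finset ι) : PrimrecPred fun a => ∃ i ∈ E, R i a := by
  classical
  induction E using Finset.induction with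
  | empty =>
    exact (PrimrecRel.comp Primrec.eq (Primrec.const 0) (Primrec.const 1)).of_eq fun a => by simp
  | insert i E _ ih => exact ((hR i).or ih).of_eq fun a => by simp

open Nat.Partrec (Code)

theorem Nat.Partrec.Code.primrecPred_mem_evaln {α : Type*} [Primcodable α] {s : α → ℕ}
    {c : α → Code} {n v : α → ℕ} (hs : Primrec s) (hc : Primrec c) (hn : Primrec n)
    (hv : Primrec v) : PrimrecPred fun a => v a ∈ evaln (s a) (c a) (n a) :=
  (PrimrecRel.comp Primrec.eq (primrec_evaln.comp ((hs.pair hc).pair hn))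
    (Primrec.option_some.comp hv)).of_eq fun a => by simp

/-! ### Large values and their finite certificates. -/

/-- Oracle computations from finite ternary oracles can be simulated by ordinary programs. -/
theorem OracleCode.exists_code_simulating (c : OracleCode) : ∃ d : Code, ∀ k S n,
    d.eval (Nat.pair (Nat.pair k S) n) = eval (restrictBelow (ternaryDigit S) k) c n := by
  have hg : Partrec₂ fun (q : ℕ × ℕ) x => restrictBelow (ternaryDigit q.2) q.1 x := by
    refine Computable.ofOption (Primrec.to_comp (Primrec.ite
      (Primrec.nat_lt.comp Primrec.snd (Primrec.fst.comp Primrec.fst))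
      (Primrec.option_some.comp (primrec₂_ternaryDigit.comp (Primrec.snd.comp Primrec.fst)
        Primrec.snd)) (Primrec.const none)))
  have h := (partrec₂_eval hg c).comp
    (Computable.unpair.comp (Computable.fst.comp Computable.unpair))
    (Computable.snd.comp Computable.unpair)
  obtain ⟨d, hd⟩ := Nat.Partrec.Code.exists_code.1 (Partrec.nat_iff.1 h)
  exact ⟨d, fun k S n => by simp [hd]⟩

/-- One-step test behind the largeness of the set of ternary `f` for which some program of `E`
outputs `v` at `n`: within the bounds `k` and `s`, either `p` is seen to disagree with the diagonal
function, or there is a ternary string that begins with the first `l` digits of `T`, avoids `p`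
afterwards, and makes a program of `E` output `v` at `n`. -/
def Meets (d : ℕ → Code) (E : Finset ℕ) (l T n v k s : ℕ) (p : ℕ → ℕ) : Prop :=
  (∃ x < k, ∃ w < 3, w ∈ Code.evaln s (Denumerable.ofNat Code x) x ∧ w ≠ p x) ∨
    ∃ S < 3 ^ k, (∀ x < k, (x < l ∧ ternaryDigit S x = ternaryDigit T x) ∨
      (¬ x < l ∧ ternaryDigit S x ≠ p x)) ∧
      ∃ j < k + 1, ∃ e ∈ E, v ∈ Code.evaln s (d e) (Nat.pair (Nat.pair j S) n)

/-- The test reads `p` only below `k`, so it is an open condition on `p`; this is what compactness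
needs. -/
theorem Meets.congr {d : ℕ → Code} {E : Finset ℕ} {l T n v k s : ℕ} {p q : ℕ → ℕ}
    (hpq : ∀ x < k, p x = q x) (h : Meets d E l T n v k s p) : Meets d E l T n v k s q := by
  obtain ⟨x, hx, w, hw, h, h'⟩ | ⟨S, hS, h, h'⟩ := h
  · exact .inl ⟨x, hx, w, hw, h, hpq x hx ▸ h'⟩
  · exact .inr ⟨S, hS, fun x hx => hpq x hx ▸ h x hx, h'⟩

/-- Every ternary function passes the test `Meets` within the bound `K`. -/
def Large (d : ℕ → Code) (E : Finset ℕ) (l T n v K : ℕ) : Prop :=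
  ∀ P < 3 ^ K, ∃ k < K, ∃ s < K, Meets d E l T n v k s (ternaryDigit P)

/-- Compactness replaces the quantifier over all ternary functions by one over the strings of a
single length `K`. -/
theorem exists_large {d : ℕ → Code} {E : Finset ℕ} {l T n v : ℕ}
    (h : ∀ p : ℕ → ℕ, (∀ x, p x < 3) → ∃ k s, Meets d E l T n v k s p) :
    ∃ K, Large d E l T n v K := by
  obtain ⟨K, hK⟩ := exists_bound_of_forall_ternary (U := Meets d E l T n v)
    (fun _ _ _ _ h => Meets.congr h) h
  exact ⟨K, fun P _ => hK _ (ternaryDigit_lt P)⟩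

theorem Large.exists_meets {d : ℕ → Code} {E : Finset ℕ} {l T n v K : ℕ}
    (h : Large d E l T n v K) {p : ℕ → ℕ} (hp : ∀ x, p x < 3) :
    ∃ k s, Meets d E l T n v k s p := by
  obtain ⟨P, hP, hPp⟩ := exists_ternaryDigit_eq K p hp
  obtain ⟨k, hk, s, -, h⟩ := h P hP
  exact ⟨k, s, h.congr fun x hx => hPp x (hx.trans hk)⟩

/-- All quantifiers are bounded and every computation is cut off by `Code.evaln`, so a certificate
of largeness can be checked, and therefore searched for, effectively. -/
theorem primrecPred_large (d : ℕ → Code) (E : Finset ℕ) (l T : ℕ) :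
    PrimrecPred fun q : ℕ × ℕ × ℕ => Large d E l T q.1 q.2.1 q.2.2 := by
  have hpow : Primrec fun k => 3 ^ k :=
    (Primrec₂.unpaired'.1 Nat.Primrec.pow).comp (Primrec.const 3) Primrec.id
  -- a tuple `(s, k, P, n, v, K)`
  have h1 : PrimrecPred fun q : ℕ × ℕ × ℕ × ℕ × ℕ × ℕ => ∃ x < q.2.1, ∃ w < 3,
      w ∈ Code.evaln q.1 (Denumerable.ofNat Code x) x ∧ w ≠ ternaryDigit q.2.2.1 x := by
    have hx : Primrec fun r : ℕ × ℕ × ℕ × ℕ × ℕ × ℕ × ℕ × ℕ => r.2.1 :=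
      Primrec.fst.comp Primrec.snd
    have hq : Primrec fun r : ℕ × ℕ × ℕ × ℕ × ℕ × ℕ × ℕ × ℕ => r.2.2 :=
      Primrec.snd.comp Primrec.snd
    refine PrimrecPred.bounded_exists (PrimrecPred.bounded_exists
      (b := fun _ => 3)
      (R := fun w (r : ℕ × ℕ × ℕ × ℕ × ℕ × ℕ × ℕ) => w ∈ Code.evaln r.2.1
        (Denumerable.ofNat Code r.1) r.1 ∧ w ≠ ternaryDigit r.2.2.2.1 r.1) (.and ?_ ?_)
      (Primrec.const 3)) (Primrec.fst.comp Primrec.snd)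
    · exact Code.primrecPred_mem_evaln (Primrec.fst.comp hq) ((Primrec.ofNat Code).comp hx) hx
        Primrec.fst
    · exact (PrimrecRel.comp Primrec.eq Primrec.fst (primrec₂_ternaryDigit.comp
        (Primrec.fst.comp (Primrec.snd.comp (Primrec.snd.comp hq))) hx)).not
  have h2 : PrimrecPred fun r : ℕ × ℕ × ℕ × ℕ × ℕ × ℕ × ℕ => ∀ x < r.2.2.1,
      (x < l ∧ ternaryDigit r.1 x = ternaryDigit T x) ∨
      (¬ x < l ∧ ternaryDigit r.1 x ≠ ternaryDigit r.2.2.2.1 x) := by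
    have hl : PrimrecPred fun q : ℕ × ℕ × ℕ × ℕ × ℕ × ℕ × ℕ × ℕ => q.1 < l :=
      Primrec.nat_lt.comp Primrec.fst (Primrec.const l)
    have hS : Primrec fun q : ℕ × ℕ × ℕ × ℕ × ℕ × ℕ × ℕ × ℕ => ternaryDigit q.2.1 q.1 :=
      primrec₂_ternaryDigit.comp (Primrec.fst.comp Primrec.snd) Primrec.fst
    refine PrimrecPred.bounded_forall (.or (.and hl ?_) (.and hl.not (.not ?_)))
      (Primrec.fst.comp (Primrec.snd.comp Primrec.snd))
    · exact PrimrecRel.comp Primrec.eq hS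
        (primrec₂_ternaryDigit.comp (Primrec.const T) Primrec.fst)
    · exact PrimrecRel.comp Primrec.eq hS (primrec₂_ternaryDigit.comp (Primrec.fst.comp
        (Primrec.snd.comp (Primrec.snd.comp (Primrec.snd.comp Primrec.snd)))) Primrec.fst)
  have h3 : PrimrecPred fun r : ℕ × ℕ × ℕ × ℕ × ℕ × ℕ × ℕ => ∃ j < r.2.2.1 + 1, ∃ e ∈ E,
      r.2.2.2.2.2.1 ∈ Code.evaln r.2.1 (d e) (Nat.pair (Nat.pair j r.1) r.2.2.2.2.1) := by
    have hn : Primrec fun q : ℕ × ℕ × ℕ × ℕ × ℕ × ℕ × ℕ × ℕ => q.2.2.2.2.2 :=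
      Primrec.snd.comp (Primrec.snd.comp (Primrec.snd.comp (Primrec.snd.comp Primrec.snd)))
    refine PrimrecPred.bounded_exists (PrimrecPred.finset_exists (fun e => ?_) E)
      (Primrec.succ.comp (Primrec.fst.comp (Primrec.snd.comp Primrec.snd)))
    exact Code.primrecPred_mem_evaln (Primrec.fst.comp (Primrec.snd.comp Primrec.snd))
      (Primrec.const _) (Primrec₂.natPair.comp (Primrec₂.natPair.comp Primrec.fst
        (Primrec.fst.comp Primrec.snd)) (Primrec.fst.comp hn))
      (Primrec.fst.comp (Primrec.snd.comp hn))
  have h4 : PrimrecPred fun q : ℕ × ℕ × ℕ × ℕ × ℕ × ℕ =>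
      Meets d E l T q.2.2.2.1 q.2.2.2.2.1 q.2.1 q.1 (ternaryDigit q.2.2.1) :=
    h1.or (PrimrecPred.bounded_exists (h2.and h3) (hpow.comp (Primrec.fst.comp Primrec.snd)))
  have hK : Primrec fun q : ℕ × ℕ × ℕ => q.2.2 := Primrec.snd.comp Primrec.snd
  exact PrimrecPred.bounded_forall (PrimrecPred.bounded_exists (PrimrecPred.bounded_exists h4
    (hK.comp (Primrec.snd.comp Primrec.snd))) (hK.comp Primrec.snd)) (hpow.comp hK)

/-- A ternary total extension of the diagonal function exists. -/
theorem exists_ternary_diagonal : ∃ p : ℕ → ℕ, (∀ x, p x < 3) ∧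
    ∀ x, ∀ w < 3, w ∈ (Denumerable.ofNat Code x).eval x → w = p x := by
  have h : ∀ x, ∃ y < 3, ∀ w < 3, w ∈ (Denumerable.ofNat Code x).eval x → w = y := by
    intro x
    by_cases hx : ∃ y < 3, y ∈ (Denumerable.ofNat Code x).eval x
    · obtain ⟨y, hy, hxy⟩ := hx
      exact ⟨y, hy, fun w _ hw => Part.mem_unique hw hxy⟩
    · exact ⟨0, by norm_num, fun w hw h => absurd ⟨w, hw, h⟩ hx⟩
  choose p hp hp' using h
  exact ⟨p, hp, hp'⟩

theorem dnr_three_nonempty : (DNR 3).Nonempty := by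
  obtain ⟨p, hp, h⟩ := exists_ternary_diagonal
  refine ⟨fun x => (p x + 1) % 3, fun x => Nat.mod_lt _ (by norm_num), fun x hx => ?_⟩
  have := h x _ (Nat.mod_lt _ (by norm_num)) hx
  have := hp x
  omega

/-- By the recursion theorem, some index `n` has as its diagonal value a number `v` that is
`Large` at `n`, provided there is such a number for every `n`. -/
theorem exists_large_diagonal_value (d : ℕ → Code) (E : Finset ℕ) (l T : ℕ)
    (h : ∀ n, ∃ v K, Large d E l T n v K) :
    ∃ n v K, Large d E l T n v K ∧ v ∈ (Denumerable.ofNat Code n).eval n := by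
  classical
  -- The search ignores its numerical input, so a program that is a fixed point of it returns, on
  -- its own index, a value large at that index.
  let search : Code → ℕ →. ℕ := fun c _ => (Nat.rfind fun m =>
    Part.some (decide (Large d E l T (Encodable.encode c) m.unpair.1 m.unpair.2))).map
      fun m => m.unpair.1
  have hsearch : Partrec₂ search := by
    refine Partrec.map (Partrec.rfind ?_)
      (Computable.fst.comp (Computable.unpair.comp Computable.snd)).to₂
    have hm : Primrec fun q : (Code × ℕ) × ℕ => q.2.unpair := Primrec.unpair.comp Primrec.snd
    exact (((primrecPred_large d E l T).comp ((Primrec.encode.comp (Primrec.fst.comp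
      Primrec.fst)).pair ((Primrec.fst.comp hm).pair (Primrec.snd.comp hm)))).decide.to_comp).partrec
  obtain ⟨c, hc⟩ := Code.fixed_point₂ hsearch
  obtain ⟨v, K, hvK⟩ := h (Encodable.encode c)
  obtain ⟨m, hm, -⟩ := Nat.rfind_min' (m := Nat.pair v K)
    (p := fun m => decide (Large d E l T (Encodable.encode c) m.unpair.1 m.unpair.2))
    (by simpa using hvK)
  refine ⟨Encodable.encode c, m.unpair.1, m.unpair.2, by simpa using Nat.rfind_spec hm, ?_⟩
  rw [Denumerable.ofNat_encode, hc]
  exact Part.mem_map _ hm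

/-- If programs of `E` compute from every member of `DNR 3` near `f` some member of `DNR 2`, then
near `f` some program of `E` is seen to make a mistake. -/
theorem exists_diagonal_value_of_forall_exists (E : Finset ℕ) {f : ℕ → ℕ} (hf : f ∈ DNR 3) (l : ℕ)
    (h : ∀ g ∈ DNR 3, (∀ x < l, g x = f x) → ∃ e ∈ E, ∃ u ∈ DNR 2, FunctionalMapsTo e g u) :
    ∃ g ∈ DNR 3, (∀ x < l, g x = f x) ∧ ∃ e ∈ E, ∃ n, ∃ v ∈ turingFunctional e g n,
      v ∈ (Denumerable.ofNat Code n).eval n := by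
  choose d hd using fun e => (OracleCode.ofNatCode e).exists_code_simulating
  obtain ⟨T, -, hT⟩ := exists_ternaryDigit_eq l f hf.1
  have hlarge : ∀ n, ∃ v K, Large d E l T n v K := by
    intro n
    by_contra! hno
    have hno' : ∀ v, ∃ p : ℕ → ℕ, (∀ x, p x < 3) ∧ ∀ k s, ¬ Meets d E l T n v k s p := by
      intro v
      by_contra! hv
      obtain ⟨K, hK⟩ := exists_large hv
      exact hno v K hK
    choose p hp hpm using hno'
    -- Here three values are essential: one remains after `p 0 x` and `p 1 x` are excluded.
    have havoid : ∀ x, ∃ y < 3, y ≠ p 0 x ∧ y ≠ p 1 x := by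
      intro x
      have h0 := hp 0 x
      have h1 := hp 1 x
      by_contra! hy
      have := hy 0
      have := hy 1
      have := hy 2
      omega
    choose r hr hr0 hr1 using havoid
    let g : ℕ → ℕ := fun x => if x < l then f x else r x
    have hgl : ∀ x < l, g x = f x := fun x hx => if_pos hx
    have hgr : ∀ x, ¬ x < l → g x = r x := fun x hx => if_neg hx
    have hg3 : ∀ x, g x < 3 := by
      intro x
      by_cases hx : x < l
      · exact hgl x hx ▸ hf.1 x
      · exact hgr x hx ▸ hr x
    have hg : g ∈ DNR 3 := by
      refine ⟨hg3, fun x hgx => ?_⟩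
      by_cases hx : x < l
      · exact hf.2 x (hgl x hx ▸ hgx)
      · rw [hgr x hx] at hgx
        obtain ⟨s, hs⟩ := Code.evaln_complete.1 hgx
        -- Failing the first half of `Meets` means that `p 0` extends the ternary part of the
        -- diagonal function, so avoiding `p 0` ensures diagonal noncomputability from `l` on.
        exact hpm 0 (x + 1) s (.inl ⟨x, x.lt_succ_self, r x, hr x, hs, hr0 x⟩)
    obtain ⟨e, he, u, hu, heu⟩ := h g hg hgl
    obtain ⟨k, hk⟩ := OracleCode.exists_mem_eval_restrictBelow g _ n _ (heu n)
    obtain ⟨S, hS, hSg⟩ := exists_ternaryDigit_eq k g hg3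
    rw [← restrictBelow_congr hSg, ← hd] at hk
    obtain ⟨s, hs⟩ := Code.evaln_complete.1 hk
    have hun : ∀ x, r x ≠ p (u n) x := by
      intro x
      have : u n = 0 ∨ u n = 1 := by
        have := hu.1 n
        omega
      rcases this with h | h <;> rw [h]
      exacts [hr0 x, hr1 x]
    refine hpm (u n) k s (.inr ⟨S, hS, fun x hx => ?_, k, k.lt_succ_self, e, he, hs⟩)
    rw [hSg x hx]
    by_cases hxl : x < l
    · exact .inl ⟨hxl, by rw [hgl x hxl, hT x hxl]⟩
    · exact .inr ⟨hxl, by rw [hgr x hxl]; exact hun x⟩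
  obtain ⟨n, v, K, hK, hv⟩ := exists_large_diagonal_value d E l T hlarge
  obtain ⟨p, hp, hpd⟩ := exists_ternary_diagonal
  obtain ⟨k, s, ⟨x, -, w, hw, hwx, hwp⟩ | ⟨S, -, hS, j, hj, e, he, hes⟩⟩ := hK.exists_meets hp
  · exact absurd (hpd x w hw (Code.evaln_sound hwx)) hwp
  -- `S` secures the computation; it need not reach length `l`, so `f` fills any gap. Beyond both,
  -- `p x + 1` modulo 3 differs from `p x` and hence from the diagonal function.
  let g : ℕ → ℕ := fun x => if x < k then ternaryDigit S x else if x < l then f x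
    else (p x + 1) % 3
  have hgl : ∀ x < l, g x = f x := by
    intro x hx
    simp only [g, hx, if_true]
    split_ifs with hxk
    · obtain ⟨-, h⟩ | ⟨h, -⟩ := hS x hxk
      exacts [h.trans (hT x hx), absurd hx h]
    · rfl
  have hg3 : ∀ x, g x < 3 := by
    intro x
    simp only [g]
    split_ifs
    exacts [ternaryDigit_lt _ _, hf.1 x, Nat.mod_lt _ (by norm_num)]
  refine ⟨g, ⟨hg3, fun x hgx => ?_⟩, hgl, e, he, n, v, ?_, hv⟩
  · by_cases hxl : x < l
    · exact hf.2 x (hgl x hxl ▸ hgx)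
    · have h1 := hpd x _ (hg3 x) hgx
      simp only [g, hxl, if_false] at h1
      split_ifs at h1 with hxk
      · obtain ⟨h, -⟩ | ⟨-, h⟩ := hS x hxk
        exacts [hxl h, h h1]
      · have := hp x
        omega
  · have := Code.evaln_sound hes
    -- Queries are answered only below `j ≤ k`, where `g` agrees with `S`.
    rw [hd, restrictBelow_congr (f' := g) fun x hx => (if_pos (by omega)).symm] at this
    exact OracleCode.mem_eval_of_restrictBelow this

/-- Finitely many functionals fail simultaneously on some member of `DNR 3` near any given one. -/
theorem exists_dnr_three_forall_not_mapsTo_dnr_two (E : Finset ℕ) :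
    ∀ f ∈ DNR 3, ∀ l, ∃ g ∈ DNR 3, (∀ x < l, g x = f x) ∧
      ∀ e ∈ E, ∀ u ∈ DNR 2, ¬ FunctionalMapsTo e g u := by
  induction E using Finset.strongInduction with
  | H E ih =>
    intro f hf l
    by_contra! hno
    obtain ⟨g, hg, hgf, e, he, n, v, hv, hvn⟩ := exists_diagonal_value_of_forall_exists E hf l hno
    obtain ⟨k, hk⟩ := OracleCode.exists_mem_eval_restrictBelow g _ n _ hv
    -- Agreement up to `k` preserves the mistake of `e`; agreement up to `l` keeps `g'` near `f`.
    -- Only `e` could then succeed on `g'`, and its mistake at `n` rules it out.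
    obtain ⟨g', hg', hgg', hE⟩ := ih (E.erase e) (Finset.erase_ssubset he) g hg (max k l)
    obtain ⟨e', he', u, hu, heu⟩ := hno g' hg' fun x hx =>
      (hgg' x (hx.trans_le (le_max_right _ _))).trans (hgf x hx)
    by_cases hee : e' = e
    · subst hee
      rw [restrictBelow_congr (f' := g') fun x hx =>
        (hgg' x (hx.trans_le (le_max_left _ _))).symm] at hk
      have hvu := Part.mem_unique (OracleCode.mem_eval_of_restrictBelow hk) (heu n)
      exact hu.2 n (hvu ▸ hvn)
    · exact hE e' (Finset.mem_erase.2 ⟨hee, he'⟩) u hu heu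

theorem not_massLE_finitelyPiecewiseComputable :
    ¬ MassLE FinitelyPiecewiseComputable (DNR 2) (DNR 3) := by
  rintro ⟨Γ, ⟨b, hb⟩, hΓ⟩
  obtain ⟨f, hf⟩ := dnr_three_nonempty
  obtain ⟨g, hg, -, h⟩ := exists_dnr_three_forall_not_mapsTo_dnr_two (Finset.range b) f hf 0
  obtain ⟨u, hu, hu2⟩ := hΓ g hg
  obtain ⟨e, he, heu⟩ := hb g u hu
  exact h e (Finset.mem_range.2 he) u hu2 heu

/-! ### Learners and the Baire category theorem. -/

theorem isClosed_dnr (k : ℕ) : IsClosed (DNR k) := by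
  have : DNR k = ⋂ n, (fun f : ℕ → ℕ => f n) ⁻¹'
      {v | v < k ∧ v ∉ (Denumerable.ofNat Code n).eval n} := by
    ext f
    simp [DNR, forall_and]
  rw [this]
  exact isClosed_iInter fun n => (isClosed_discrete _).preimage (continuous_apply n)

theorem isClosed_setOf_initSeg_mem (n : ℕ) (s : Set (List ℕ)) : IsClosed {f : ℕ → ℕ | initSeg f n ∈ s} := by
  rw [← isOpen_compl_iff, isOpen_iff_forall_mem_open]
  intro f hf
  refine ⟨PiNat.cylinder f n, fun g hg => ?_, PiNat.isOpen_cylinder _ _ _,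
    PiNat.self_mem_cylinder _ _⟩
  have : initSeg g n = initSeg f n :=
    List.map_congr_left fun x hx => hg x (List.mem_range.1 hx)
  simpa [this] using hf

/-- A learner that converges on every member of a nonempty closed set has a constant limit near
some member of the set. -/
theorem exists_locally_constant_limit {C : Set (ℕ → ℕ)} (hC : IsClosed C) (hne : C.Nonempty)
    {Ψ : List ℕ →. ℕ} (h : ∀ g ∈ C, ∃ i, ∀ᶠ n in Filter.atTop, i ∈ Ψ (initSeg g n)) :
    ∃ f ∈ C, ∃ l i, ∀ g ∈ C, (∀ x < l, g x = f x) →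
      ∀ᶠ n in Filter.atTop, i ∈ Ψ (initSeg g n) := by
  have : Nonempty C := hne.to_subtype
  have : PolishSpace C := hC.polishSpace
  -- These countably many closed sets fix both the limit and a stage of stabilization; since they
  -- cover `C`, one of them has interior.
  let A : ℕ × ℕ → Set C := fun q => {g | ∀ n, q.2 ≤ n → q.1 ∈ Ψ (initSeg g n)}
  have hA : ∀ q, IsClosed (A q) := by
    intro q
    simp only [A, Set.ofPred_forall]
    exact isClosed_iInter fun n => isClosed_iInter fun _ =>
      (isClosed_setOf_initSeg_mem n {s | q.1 ∈ Ψ s}).preimage continuous_subtype_val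
  have hcov : ⋃ q, A q = Set.univ := by
    refine Set.eq_univ_of_forall fun g => ?_
    obtain ⟨i, hi⟩ := h g g.2
    obtain ⟨m, hm⟩ := Filter.eventually_atTop.1 hi
    exact Set.mem_iUnion.2 ⟨(i, m), hm⟩
  obtain ⟨q, f, hf⟩ := nonempty_interior_of_iUnion_of_closed hA hcov
  obtain ⟨O, hO, hOA⟩ := isOpen_induced_iff.1 (isOpen_interior (s := A q))
  have hfO : (f : ℕ → ℕ) ∈ O := by
    rw [← hOA] at hf
    exact hf
  obtain ⟨_, ⟨y, l, rfl⟩, hfy, hyO⟩ :=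
    (PiNat.isTopologicalBasis_cylinders _).exists_subset_of_mem_open hfO hO
  refine ⟨f, f.2, l, q.1, fun g hg hgf => ?_⟩
  have hgO : g ∈ O := hyO fun x hx => (hgf x hx).trans (hfy x hx)
  have hgA : (⟨g, hg⟩ : C) ∈ interior (A q) := by
    rw [← hOA]
    exact hgO
  exact Filter.eventually_atTop.2 ⟨q.2, interior_subset hgA⟩

theorem not_massLE_learnable : ¬ MassLE Learnable (DNR 2) (DNR 3) := by
  rintro ⟨Γ, ⟨Ψ, -, hΨ⟩, hΓ⟩
  have hid : ∀ g ∈ DNR 3, ∃ u ∈ DNR 2, Identifies Ψ g u := by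
    intro g hg
    obtain ⟨u, hu, hu2⟩ := hΓ g hg
    exact ⟨u, hu2, hΨ g u hu⟩
  obtain ⟨f, hf, l, i, hi⟩ := exists_locally_constant_limit (isClosed_dnr 3) dnr_three_nonempty
    fun g hg => (hid g hg).elim fun u hu => hu.2.imp fun _ h => h.1
  obtain ⟨g, hg, hgf, h⟩ := exists_dnr_three_forall_not_mapsTo_dnr_two {i} f hf l
  obtain ⟨u, hu, j, hj, hju⟩ := hid g hg
  obtain ⟨n, hn, hn'⟩ := (hj.and (hi g hg hgf)).exists
  exact h i (Finset.mem_singleton_self i) u hu (Part.mem_unique hn hn' ▸ hju)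

/-! ### The identity reductions and the conclusion. -/

theorem functionalMapsTo_oracle (g : ℕ → ℕ) :
    FunctionalMapsTo (OracleCode.encodeCode .oracle) g g := by
  intro n
  rw [turingFunctional, OracleCode.ofNatCode_encodeCode]
  exact Part.mem_some _

theorem dnr_mono {k l : ℕ} (h : k ≤ l) : DNR k ⊆ DNR l :=
  fun _ hf => ⟨fun n => (hf.1 n).trans_le h, hf.2⟩

theorem massLE_finitelyPiecewiseComputable_of_subset {P Q : Set (ℕ → ℕ)} (h : Q ⊆ P) :
    MassLE FinitelyPiecewiseComputable P Q := by
  refine ⟨fun g => Part.some g, ⟨OracleCode.encodeCode .oracle + 1, fun g u hu => ?_⟩,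
    fun g hg => ⟨g, Part.mem_some g, h hg⟩⟩
  obtain rfl := Part.mem_some_iff.1 hu
  exact ⟨_, Nat.lt_succ_self _, functionalMapsTo_oracle _⟩

theorem massLE_learnable_of_subset {P Q : Set (ℕ → ℕ)} (h : Q ⊆ P) : MassLE Learnable P Q := by
  refine ⟨fun g => Part.some g, ⟨fun _ => Part.some (OracleCode.encodeCode .oracle),
    (Computable.const _).partrec, fun g u hu => ?_⟩, fun g hg => ⟨g, Part.mem_some g, h hg⟩⟩
  obtain rfl := Part.mem_some_iff.1 hu
  exact ⟨_, Filter.Eventually.of_forall fun _ => Part.mem_some _, functionalMapsTo_oracle _⟩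

theorem mainTheorem9 :
    MassLT FinitelyPiecewiseComputable (DNR 3) (DNR 2) ∧
      MassLT Learnable (DNR 3) (DNR 2) := by
  exact ⟨⟨massLE_finitelyPiecewiseComputable_of_subset (dnr_mono (by norm_num)),
      not_massLE_finitelyPiecewiseComputable⟩,
    ⟨massLE_learnable_of_subset (dnr_mono (by norm_num)), not_massLE_learnable⟩⟩
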